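/- **Conventions.** All algebras are non-empty. For algebras $\langle A,\wedge,\vee,\to,\neg\rangle$ and for formulas, the strong implication is $x\Rightarrow y:=(x\to y)\wedge(\neg y\to\neg x)$. Formulas are built from a denumerable set of variables. A *logic* is a substitution-invariant consequence relation $\vdash$ (not necessarily finitary) on formulas; a *strengthening* of a logic is a logic in the same language whose consequence relation contains the given one. *The logic $\mathcal S$.* Language $\langle\wedge,\vee,\Rightarrow,\neg,0\rangle$, with $1:=\neg 0$, $\varphi\Leftrightarrow\psi:=(\varphi\Rightarrow\psi)\wedge(\psi\Rightarrow\varphi)$, $\varphi\Rightarrow^2\psi:=\varphi\Rightarrow(\varphi\Rightarrow\psi)$ and, for a finite (possibly empty) list $\Gamma=(\varphi_1,\dots,\varphi_n)$, $\Gamma\Rightarrow\varphi:=\varphi_1\Rightarrow(\cdots\Rightarrow(\varphi_n\Rightarrow\varphi)\cdots)$ and $\Gamma\Rightarrow^2\varphi:=\varphi_1\Rightarrow^2(\cdots\Rightarrow^2(\varphi_n\Rightarrow^2\varphi)\cdots)$. Axioms: $\varphi\Rightarrow\varphi$; $0\Rightarrow\psi$; $\neg\varphi\Rightarrow(\varphi\Rightarrow0)$;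 $1$; $(\varphi\Rightarrow\psi)\Leftrightarrow(\neg\psi\Rightarrow\neg\varphi)$. Rules (premises / conclusion): - $\Gamma\Rightarrow(\varphi\Rightarrow(\psi\Rightarrow\gamma))\ /\ \Gamma\Rightarrow(\psi\Rightarrow(\varphi\Rightarrow\gamma))$; - $\varphi\Rightarrow(\varphi\Rightarrow(\varphi\Rightarrow\gamma))\ /\ \varphi\Rightarrow(\varphi\Rightarrow\gamma)$; - $\Gamma\Rightarrow\varphi,\ \varphi\Rightarrow\gamma\ /\ \Gamma\Rightarrow\gamma$; - $\Gamma\Rightarrow\varphi,\ \psi\Rightarrow\gamma\ /\ \Gamma\Rightarrow((\varphi\Rightarrow\psi)\Rightarrow\gamma)$; - $\gamma\ /\ \varphi\Rightarrow\gamma$; - $\varphi\Rightarrow\gamma\ /\ (\varphi\wedge\psi)\Rightarrow\gamma$; $\quad\psi\Rightarrow\gamma\ /\ (\varphi\wedge\psi)\Rightarrow\gamma$; $\quad\Gamma\Rightarrow\varphi,\ \Gamma\Rightarrow\psi\ /\ \Gamma\Rightarrow(\varphi\wedge\psi)$; - $\varphi\Rightarrow\gamma,\ \psi\Rightarrow\gamma\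 /\ (\varphi\vee\psi)\Rightarrow\gamma$; $\quad\varphi\Rightarrow^2\gamma,\ \psi\Rightarrow^2\gamma\ /\ (\varphi\vee\psi)\Rightarrow^2\gamma$; - $\Gamma\Rightarrow\varphi\ /\ \Gamma\Rightarrow(\varphi\vee\psi)$; $\quad\Gamma\Rightarrow\psi\ /\ \Gamma\Rightarrow(\varphi\vee\psi)$; - $(\varphi\wedge\neg\psi)\Rightarrow\gamma\ /\ \neg(\varphi\Rightarrow\psi)\Rightarrow\gamma$; $\quad\Gamma\Rightarrow^2(\varphi\wedge\neg\psi)\ /\ \Gamma\Rightarrow^2\neg(\varphi\Rightarrow\psi)$; - $(\neg\varphi\vee\neg\psi)\Rightarrow\gamma\ /\ \neg(\varphi\wedge\psi)\Rightarrow\gamma$; $\quad\Gamma\Rightarrow(\neg\varphi\vee\neg\psi)\ /\ \Gamma\Rightarrow\neg(\varphi\wedge\psi)$; - $(\neg\varphi\wedge\neg\psi)\Rightarrow\gamma\ /\ \neg(\varphi\vee\psi)\Rightarrow\gamma$; $\quad\Gamma\Rightarrow(\neg\varphi\wedge\neg\psi)\ /\ \Gamma\Rightarrow\neg(\varphi\vee\psi)$;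 - $\varphi\Rightarrow\gamma\ /\ \neg\neg\varphi\Rightarrow\gamma$; $\quad\Gamma\Rightarrow\varphi\ /\ \Gamma\Rightarrow\neg\neg\varphi$. *$\mathcal S$-algebras* are the algebras $\langle A,\wedge,\vee,\Rightarrow,\neg,0,1\rangle$ satisfying $\varphi\approx1$ for each axiom $\varphi$ of $\mathcal S$ (where the abbreviation $1$ inside formulas stands for $\neg 0$), $x\Rightarrow x\approx1$, for each rule of $\mathcal S$ the quasiequation $[\varphi_1\approx1\ \&\cdots\&\ \varphi_n\approx1]\Longrightarrow\varphi\approx1$, and $[x\Rightarrow y\approx1\ \&\ y\Rightarrow x\approx1]\Longrightarrow x\approx y$. *The logics $\mathcal N4$ and $\mathcal N3$.* Language $\langle\wedge,\vee,\to,\neg\rangle$, with $\varphi\leftrightarrow\psi:=(\varphi\to\psi)\wedge(\psi\to\varphi)$. $\mathcal N4$ has modus ponens as its only rule and the axioms $\varphi\to(\psi\to\varphi)$; $(\varphi\to(\psi\to\gamma))\to((\varphi\to\psi)\to(\varphi\to\gamma))$; $(\varphi\wedge\psi)\to\varphi$; $(\varphi\wedge\psi)\to\psi$; $(\varphi\to\psi)\to((\varphi\to\gamma)\to(\varphi\to(\psi\wedge\gamma)))$;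 $\varphi\to(\varphi\vee\psi)$; $\psi\to(\varphi\vee\psi)$; $(\varphi\to\gamma)\to((\psi\to\gamma)\to((\varphi\vee\psi)\to\gamma))$; $\neg\neg\varphi\leftrightarrow\varphi$; $\neg(\varphi\vee\psi)\leftrightarrow(\neg\varphi\wedge\neg\psi)$; $\neg(\varphi\wedge\psi)\leftrightarrow(\neg\varphi\vee\neg\psi)$; $\neg(\varphi\to\psi)\leftrightarrow(\varphi\wedge\neg\psi)$. $\mathcal N3$ adds the axiom $\neg\varphi\to(\varphi\to\psi)$. Over the language of strong implication, $\mathcal N4$ is its $\langle\wedge,\vee,\Rightarrow,\neg\rangle$-fragment, and $\mathcal N3$ is its $\langle\wedge,\vee,\Rightarrow,\neg,0\rangle$-fragment where $0:=\neg(p\to p)$ for a fixed variable $p$ (and $1:=\neg0$). *$\mathcal N4$-lattices* are the algebras $\langle A,\wedge,\vee,\to,\neg\rangle$ such that: (1) $\langle A,\wedge,\vee,\neg\rangle$ is a De Morgan lattice, with order $\le$; (2) the relation $a\preceq b$ iff $(a\to b)\to(a\to b)=a\to b$ is a pre-order; (3) the relation $a\equiv b$ iff $a\preceq b$ and $b\preceq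 a$ is compatible with $\wedge,\vee,\to$, and $\langle A,\wedge,\vee,\to\rangle/{\equiv}$ is an implicative (i.e. Brouwerian) lattice; (4) $\neg(a\to b)\equiv a\wedge\neg b$; (5) $a\le b$ iff $a\preceq b$ and $\neg b\preceq\neg a$. *$\mathcal N3$-lattices* are the $\mathcal N4$-lattices satisfying $\neg x\to(x\to y)\approx x\to x$. An algebra $\langle A,\wedge,\vee,\Rightarrow,\neg,0,1\rangle$ is called an $\mathcal N4$-lattice if $\Rightarrow$ is the strong implication of some $\mathcal N4$-lattice $\langle A,\wedge,\vee,\to,\neg\rangle$ (with no condition on $0,1$), and an $\mathcal N3$-lattice if $\Rightarrow$ is the strong implication of some $\mathcal N3$-lattice $\langle A,\wedge,\vee,\to,\neg\rangle$ with $x\to x=1$ for all $x$ and $0=\neg1$. **Proposition.** 1. $\mathcal N3\text{-lattices}=\mathcal S\text{-algebras}\cap\mathcal N4\text{-lattices}$. That is: (a) a non-empty algebra $\langle A,\wedge,\vee,\to,\neg\rangle$ is an $\mathcal N3$-lattice if and only if it is an $\mathcal N4$-lattice and, for some $0,1\in A$, $\langle A,\wedge,\vee,\Rightarrow,\neg,0,1\rangle$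 is an $\mathcal S$-algebra; (b) an algebra $\langle A,\wedge,\vee,\Rightarrow,\neg,0,1\rangle$ is an $\mathcal N3$-lattice if and only if it is both an $\mathcal S$-algebra and an $\mathcal N4$-lattice. 2. Consequently, over the language of strong implication, $\mathcal N3$ is the join of $\mathcal S$ and $\mathcal N4$ among the strengthenings of $\mathcal S$: $\mathcal N3$ is a logic whose consequence relation contains those of $\mathcal S$ and of $\mathcal N4$, and every logic in the language $\langle\wedge,\vee,\Rightarrow,\neg,0\rangle$ whose consequence relation contains those of $\mathcal S$ and of $\mathcal N4$ also contains that of $\mathcal N3$. -/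

import Mathlib

universe u

namespace Nelson

/-! ### Formulas in the language `⟨∧, ∨, ⇒, ¬, 0⟩` and Nelson's calculus for the logic S -/

/-- Formulas over `⟨∧, ∨, ⇒, ¬, 0⟩`, with a denumerable set of variables. -/
inductive SFm : Type
  | var : ℕ → SFm
  | and : SFm → SFm → SFm
  | or : SFm → SFm → SFm
  | imp : SFm → SFm → SFm
  | neg : SFm → SFm
  | zero : SFm

infixr:60 " ⇒ˢ " => SFm.imp
infixl:70 " ∧ˢ " => SFm.and
infixl:65 " ∨ˢ " => SFm.or
prefix:max "¬ˢ" => SFm.neg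

/-- The abbreviation `1 := ¬0`. -/
def SFm.one : SFm := ¬ˢ SFm.zero

/-- The abbreviation `φ ⇔ ψ := (φ ⇒ ψ) ∧ (ψ ⇒ φ)`. -/
def SFm.iff (φ ψ : SFm) : SFm := (φ ⇒ˢ ψ) ∧ˢ (ψ ⇒ˢ φ)

/-- The abbreviation `φ ⇒² ψ := φ ⇒ (φ ⇒ ψ)`. -/
def SFm.imp2 (φ ψ : SFm) : SFm := φ ⇒ˢ (φ ⇒ˢ ψ)

/-- `Γ ⇒ φ`, that is `γ₁ ⇒ (γ₂ ⇒ (⋯ (γₙ ⇒ φ)))`, for a finite list `Γ`. -/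
def SFm.impList (Γ : List SFm) (φ : SFm) : SFm := Γ.foldr SFm.imp φ

/-- `Γ ⇒² φ`, that is `γ₁ ⇒² (γ₂ ⇒² (⋯ (γₙ ⇒² φ)))`, for a finite list `Γ`. -/
def SFm.imp2List (Γ : List SFm) (φ : SFm) : SFm := Γ.foldr SFm.imp2 φ

open SFm in
/-- The axioms of S. -/
inductive SAxiom : SFm → Prop
  | a1 (φ : SFm) : SAxiom (φ ⇒ˢ φ)
  | a2 (ψ : SFm) : SAxiom (zero ⇒ˢ ψ)
  | a3 (φ : SFm) : SAxiom (¬ˢ φ ⇒ˢ (φ ⇒ˢ zero))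
  | a4 : SAxiom one
  | a5 (φ ψ : SFm) : SAxiom (SFm.iff (φ ⇒ˢ ψ) (¬ˢ ψ ⇒ˢ ¬ˢ φ))

open SFm in
/-- The rules of S: `SRule premises conclusion`. -/
inductive SRule : List SFm → SFm → Prop
  | p (Γ : List SFm) (φ ψ γ : SFm) :
      SRule [impList Γ (φ ⇒ˢ (ψ ⇒ˢ γ))] (impList Γ (ψ ⇒ˢ (φ ⇒ˢ γ)))
  | c (φ γ : SFm) : SRule [φ ⇒ˢ (φ ⇒ˢ (φ ⇒ˢ γ))] (φ ⇒ˢ (φ ⇒ˢ γ))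
  | e (Γ : List SFm) (φ γ : SFm) : SRule [impList Γ φ, φ ⇒ˢ γ] (impList Γ γ)
  | impL (Γ : List SFm) (φ ψ γ : SFm) :
      SRule [impList Γ φ, ψ ⇒ˢ γ] (impList Γ ((φ ⇒ˢ ψ) ⇒ˢ γ))
  | impR (φ γ : SFm) : SRule [γ] (φ ⇒ˢ γ)
  | andL1 (φ ψ γ : SFm) : SRule [φ ⇒ˢ γ] ((φ ∧ˢ ψ) ⇒ˢ γ)
  | andL2 (φ ψ γ : SFm) : SRule [ψ ⇒ˢ γ] ((φ ∧ˢ ψ) ⇒ˢ γ)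
  | andR (Γ : List SFm) (φ ψ : SFm) :
      SRule [impList Γ φ, impList Γ ψ] (impList Γ (φ ∧ˢ ψ))
  | orL1 (φ ψ γ : SFm) : SRule [φ ⇒ˢ γ, ψ ⇒ˢ γ] ((φ ∨ˢ ψ) ⇒ˢ γ)
  | orL2 (φ ψ γ : SFm) : SRule [imp2 φ γ, imp2 ψ γ] (imp2 (φ ∨ˢ ψ) γ)
  | orR1 (Γ : List SFm) (φ ψ : SFm) : SRule [impList Γ φ] (impList Γ (φ ∨ˢ ψ))
  | orR2 (Γ : List SFm) (φ ψ : SFm) : SRule [impList Γ ψ] (impList Γ (φ ∨ˢ ψ))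
  | negImpL (φ ψ γ : SFm) : SRule [(φ ∧ˢ ¬ˢ ψ) ⇒ˢ γ] (¬ˢ (φ ⇒ˢ ψ) ⇒ˢ γ)
  | negImpR (Γ : List SFm) (φ ψ : SFm) :
      SRule [imp2List Γ (φ ∧ˢ ¬ˢ ψ)] (imp2List Γ (¬ˢ (φ ⇒ˢ ψ)))
  | negAndL (φ ψ γ : SFm) : SRule [(¬ˢ φ ∨ˢ ¬ˢ ψ) ⇒ˢ γ] (¬ˢ (φ ∧ˢ ψ) ⇒ˢ γ)
  | negAndR (Γ : List SFm) (φ ψ : SFm) :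
      SRule [impList Γ (¬ˢ φ ∨ˢ ¬ˢ ψ)] (impList Γ (¬ˢ (φ ∧ˢ ψ)))
  | negOrL (φ ψ γ : SFm) : SRule [(¬ˢ φ ∧ˢ ¬ˢ ψ) ⇒ˢ γ] (¬ˢ (φ ∨ˢ ψ) ⇒ˢ γ)
  | negOrR (Γ : List SFm) (φ ψ : SFm) :
      SRule [impList Γ (¬ˢ φ ∧ˢ ¬ˢ ψ)] (impList Γ (¬ˢ (φ ∨ˢ ψ)))
  | negNegL (φ γ : SFm) : SRule [φ ⇒ˢ γ] (¬ˢ (¬ˢ φ) ⇒ˢ γ)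
  | negNegR (Γ : List SFm) (φ : SFm) : SRule [impList Γ φ] (impList Γ (¬ˢ (¬ˢ φ)))

/-- The consequence relation of S. -/
inductive LogicS (Γ : Set SFm) : SFm → Prop
  | hyp {φ : SFm} : φ ∈ Γ → LogicS Γ φ
  | ax {φ : SFm} : SAxiom φ → LogicS Γ φ
  | rule {ps : List SFm} {φ : SFm} : SRule ps φ → (∀ ψ ∈ ps, LogicS Γ ψ) → LogicS Γ φ

/-! ### Formulas in the language `⟨∧, ∨, →, ¬⟩` and the calculi N4 and N3 -/

/-- Formulas over `⟨∧, ∨, →, ¬⟩`, with a denumerable set of variables. -/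
inductive NFm : Type
  | var : ℕ → NFm
  | and : NFm → NFm → NFm
  | or : NFm → NFm → NFm
  | imp : NFm → NFm → NFm
  | neg : NFm → NFm

infixr:60 " →ⁿ " => NFm.imp
infixl:70 " ∧ⁿ " => NFm.and
infixl:65 " ∨ⁿ " => NFm.or
prefix:max "¬ⁿ" => NFm.neg

/-- The abbreviation `φ ↔ ψ := (φ → ψ) ∧ (ψ → φ)`. -/
def NFm.iff (φ ψ : NFm) : NFm := (φ →ⁿ ψ) ∧ⁿ (ψ →ⁿ φ)

/-- Strong implication: `φ ⇒ ψ := (φ → ψ) ∧ (¬ψ → ¬φ)`. -/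
def NFm.strongImp (φ ψ : NFm) : NFm := (φ →ⁿ ψ) ∧ⁿ (¬ⁿ ψ →ⁿ ¬ⁿ φ)

open NFm in
/-- The axioms of N4. -/
inductive N4Axiom : NFm → Prop
  | n1 (φ ψ : NFm) : N4Axiom (φ →ⁿ (ψ →ⁿ φ))
  | n2 (φ ψ γ : NFm) : N4Axiom ((φ →ⁿ (ψ →ⁿ γ)) →ⁿ ((φ →ⁿ ψ) →ⁿ (φ →ⁿ γ)))
  | n3 (φ ψ : NFm) : N4Axiom ((φ ∧ⁿ ψ) →ⁿ φ)
  | n4 (φ ψ : NFm) : N4Axiom ((φ ∧ⁿ ψ) →ⁿ ψ)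
  | n5 (φ ψ γ : NFm) : N4Axiom ((φ →ⁿ ψ) →ⁿ ((φ →ⁿ γ) →ⁿ (φ →ⁿ (ψ ∧ⁿ γ))))
  | n6 (φ ψ : NFm) : N4Axiom (φ →ⁿ (φ ∨ⁿ ψ))
  | n7 (φ ψ : NFm) : N4Axiom (ψ →ⁿ (φ ∨ⁿ ψ))
  | n8 (φ ψ γ : NFm) : N4Axiom ((φ →ⁿ γ) →ⁿ ((ψ →ⁿ γ) →ⁿ ((φ ∨ⁿ ψ) →ⁿ γ)))
  | n9 (φ : NFm) : N4Axiom (NFm.iff (¬ⁿ (¬ⁿ φ)) φ)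
  | n10 (φ ψ : NFm) : N4Axiom (NFm.iff (¬ⁿ (φ ∨ⁿ ψ)) (¬ⁿ φ ∧ⁿ ¬ⁿ ψ))
  | n11 (φ ψ : NFm) : N4Axiom (NFm.iff (¬ⁿ (φ ∧ⁿ ψ)) (¬ⁿ φ ∨ⁿ ¬ⁿ ψ))
  | n12 (φ ψ : NFm) : N4Axiom (NFm.iff (¬ⁿ (φ →ⁿ ψ)) (φ ∧ⁿ ¬ⁿ ψ))

/-- The axioms of N3: those of N4 and `¬φ → (φ → ψ)`. -/
inductive N3Axiom : NFm → Prop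
  | ofN4 {φ : NFm} : N4Axiom φ → N3Axiom φ
  | n13 (φ ψ : NFm) : N3Axiom (¬ⁿ φ →ⁿ (φ →ⁿ ψ))

/-- Derivability from `Γ` and the axioms `Ax` by modus ponens. -/
inductive MPDeriv (Ax : NFm → Prop) (Γ : Set NFm) : NFm → Prop
  | hyp {φ : NFm} : φ ∈ Γ → MPDeriv Ax Γ φ
  | ax {φ : NFm} : Ax φ → MPDeriv Ax Γ φ
  | mp {φ ψ : NFm} : MPDeriv Ax Γ φ → MPDeriv Ax Γ (φ →ⁿ ψ) → MPDeriv Ax Γ ψ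

/-- The consequence relation of N4. -/
def LogicN4 : Set NFm → NFm → Prop := MPDeriv N4Axiom

/-- The consequence relation of N3. -/
def LogicN3 : Set NFm → NFm → Prop := MPDeriv N3Axiom

/-! ### N4 and N3 in the language of the strong implication -/

/-- Read `⇒` as strong implication and `0` as `¬(p → p)`. (All formulas `p → p` are
interchangeable in N3. In N4 there is no constant, and this clause is not used there.) -/
def SFm.toN : SFm → NFm
  | .var n => .var n
  | .and φ ψ => φ.toN ∧ⁿ ψ.toN
  | .or φ ψ => φ.toN ∨ⁿ ψ.toN
  | .imp φ ψ => NFm.strongImp φ.toN ψ.toN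
  | .neg φ => ¬ⁿ φ.toN
  | .zero => ¬ⁿ (NFm.var 0 →ⁿ NFm.var 0)

/-- The formula belongs to the sublanguage `⟨∧, ∨, ⇒, ¬⟩`. -/
def SFm.ConstFree : SFm → Prop
  | .var _ => True
  | .and φ ψ => φ.ConstFree ∧ ψ.ConstFree
  | .or φ ψ => φ.ConstFree ∧ ψ.ConstFree
  | .imp φ ψ => φ.ConstFree ∧ ψ.ConstFree
  | .neg φ => φ.ConstFree
  | .zero => False

/-- The `⟨∧, ∨, ⇒, ¬⟩`-fragment of N4. -/
def StrongN4 (Γ : Set SFm) (φ : SFm) : Prop :=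
  (∀ γ ∈ Γ, γ.ConstFree) ∧ φ.ConstFree ∧ LogicN4 (SFm.toN '' Γ) φ.toN

/-- N3 in the language `⟨∧, ∨, ⇒, ¬, 0⟩`, with `1 := ¬0`. -/
def StrongN3 (Γ : Set SFm) (φ : SFm) : Prop := LogicN3 (SFm.toN '' Γ) φ.toN

/-- Simultaneous substitution. -/
def SFm.subst (σ : ℕ → SFm) : SFm → SFm
  | .var n => σ n
  | .and φ ψ => φ.subst σ ∧ˢ ψ.subst σ
  | .or φ ψ => φ.subst σ ∨ˢ ψ.subst σ
  | .imp φ ψ => φ.subst σ ⇒ˢ ψ.subst σ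
  | .neg φ => ¬ˢ (φ.subst σ)
  | .zero => .zero

/-- A logic: a substitution-invariant (not necessarily finitary) consequence relation. -/
structure IsLogic (L : Set SFm → SFm → Prop) : Prop where
  refl : ∀ Γ φ, φ ∈ Γ → L Γ φ
  mono : ∀ Γ Δ φ, Γ ⊆ Δ → L Γ φ → L Δ φ
  cut : ∀ Γ Δ φ, (∀ δ ∈ Δ, L Γ δ) → L Δ φ → L Γ φ
  subst : ∀ Γ φ (σ : ℕ → SFm), L Γ φ → L (SFm.subst σ '' Γ) (φ.subst σ)

/-! ### S-algebras -/

/-- Algebras of type `⟨∧, ∨, ⇒, ¬, 0, 1⟩` on a carrier `A`. -/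
structure StrongAlg (A : Type u) where
  meet : A → A → A
  join : A → A → A
  imp : A → A → A
  neg : A → A
  zero : A
  one : A

/-- The value of a formula under a valuation. -/
def StrongAlg.eval {A : Type u} (S : StrongAlg A) (v : ℕ → A) : SFm → A
  | .var n => v n
  | .and φ ψ => S.meet (S.eval v φ) (S.eval v ψ)
  | .or φ ψ => S.join (S.eval v φ) (S.eval v ψ)
  | .imp φ ψ => S.imp (S.eval v φ) (S.eval v ψ)
  | .neg φ => S.neg (S.eval v φ)
  | .zero => S.zero

/-- S-algebras: the equation `φ ≈ 1` for each axiom, the quasiequation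
`φ₁ ≈ 1 & ⋯ & φₙ ≈ 1 ⟹ φ ≈ 1` for each rule, `x ⇒ x ≈ 1`, and
`x ⇒ y ≈ 1 & y ⇒ x ≈ 1 ⟹ x ≈ y`. -/
structure StrongAlg.IsSAlgebra {A : Type u} (S : StrongAlg A) : Prop where
  axiom_eq : ∀ (v : ℕ → A) (φ : SFm), SAxiom φ → S.eval v φ = S.one
  imp_self : ∀ a : A, S.imp a a = S.one
  rule_quasieq : ∀ (v : ℕ → A) (ps : List SFm) (φ : SFm), SRule ps φ →
    (∀ ψ ∈ ps, S.eval v ψ = S.one) → S.eval v φ = S.one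
  antisymm : ∀ a b : A, S.imp a b = S.one → S.imp b a = S.one → a = b

/-! ### N4-lattices and N3-lattices -/

/-- `⟨B, ∧, ∨⟩` is a lattice. -/
structure IsLatticeOps {B : Type u} (meet join : B → B → B) : Prop where
  meet_comm : ∀ a b, meet a b = meet b a
  join_comm : ∀ a b, join a b = join b a
  meet_assoc : ∀ a b c, meet (meet a b) c = meet a (meet b c)
  join_assoc : ∀ a b c, join (join a b) c = join a (join b c)
  meet_join_absorb : ∀ a b, meet a (join a b) = a
  join_meet_absorb : ∀ a b, join a (meet a b) = a

/-- De Morgan lattices: distributive lattices with an involution satisfying De Morgan's laws. -/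
structure IsDeMorganLattice {B : Type u} (meet join : B → B → B) (neg : B → B) : Prop where
  lattice : IsLatticeOps meet join
  distrib : ∀ a b c, meet a (join b c) = join (meet a b) (meet a c)
  neg_neg : ∀ a, neg (neg a) = a
  neg_join : ∀ a b, neg (join a b) = meet (neg a) (neg b)
  neg_meet : ∀ a b, neg (meet a b) = join (neg a) (neg b)

/-- Implicative lattices (Brouwerian lattices): lattices with a greatest element in which
`a ∧ b ≤ c` iff `a ≤ b → c`. -/
structure IsImplicativeLattice {B : Type u} (meet join imp : B → B → B) : Prop where
  lattice : IsLatticeOps meet join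
  top : ∃ t, ∀ a, meet a t = a
  residuation : ∀ a b c, meet (meet a b) c = meet a b ↔ meet a (imp b c) = a

/-- Algebras of type `⟨∧, ∨, →, ¬⟩` on a carrier `A`. -/
structure WeakAlg (A : Type u) where
  meet : A → A → A
  join : A → A → A
  imp : A → A → A
  neg : A → A

namespace WeakAlg

variable {A : Type u} (M : WeakAlg A)

/-- The lattice order. -/
def le (a b : A) : Prop := M.meet a b = a

/-- `a ≼ b` iff `(a → b) → (a → b) = a → b`. -/
def prec (a b : A) : Prop := M.imp (M.imp a b) (M.imp a b) = M.imp a b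

/-- `a ≡ b` iff `a ≼ b` and `b ≼ a`. -/
def equiv (a b : A) : Prop := M.prec a b ∧ M.prec b a

/-- If `≼` is a pre-order, then `≡` is an equivalence relation. -/
def equivSetoid (hr : ∀ a, M.prec a a) (ht : ∀ a b c, M.prec a b → M.prec b c → M.prec a c) :
    Setoid A where
  r := M.equiv
  iseqv :=
    { refl := fun a => ⟨hr a, hr a⟩
      symm := fun h => ⟨h.2, h.1⟩
      trans := fun h k => ⟨ht _ _ _ h.1 k.1, ht _ _ _ k.2 h.2⟩ }

/-- The relation `≡` is compatible with the operation `f`. -/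
def Compatible (f : A → A → A) : Prop :=
  ∀ a a' b b', M.equiv a a' → M.equiv b b' → M.equiv (f a b) (f a' b')

/-- N4-lattices. -/
structure IsN4Lattice : Prop where
  deMorgan : IsDeMorganLattice M.meet M.join M.neg
  prec_refl : ∀ a, M.prec a a
  prec_trans : ∀ a b c, M.prec a b → M.prec b c → M.prec a c
  meet_compat : M.Compatible M.meet
  join_compat : M.Compatible M.join
  imp_compat : M.Compatible M.imp
  /-- The quotient by `≡` is an implicative lattice. -/
  quotient : IsImplicativeLattice (B := Quotient (M.equivSetoid prec_refl prec_trans))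
    (Quotient.map₂ M.meet fun _ _ h _ _ k => meet_compat _ _ _ _ h k)
    (Quotient.map₂ M.join fun _ _ h _ _ k => join_compat _ _ _ _ h k)
    (Quotient.map₂ M.imp fun _ _ h _ _ k => imp_compat _ _ _ _ h k)
  neg_imp : ∀ a b, M.equiv (M.neg (M.imp a b)) (M.meet a (M.neg b))
  le_iff : ∀ a b, M.le a b ↔ M.prec a b ∧ M.prec (M.neg b) (M.neg a)

/-- N3-lattices: N4-lattices satisfying `¬x → (x → y) ≈ x → x`. -/
structure IsN3Lattice : Prop where
  isN4 : M.IsN4Lattice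
  explosion : ∀ a b, M.imp (M.neg a) (M.imp a b) = M.imp a a

/-- Strong implication: `a ⇒ b := (a → b) ∧ (¬b → ¬a)`. -/
def strongImp (a b : A) : A := M.meet (M.imp a b) (M.imp (M.neg b) (M.neg a))

/-- The algebra `⟨A, ∧, ∨, ⇒, ¬, z, o⟩`. -/
def toStrong (z o : A) : StrongAlg A where
  meet := M.meet
  join := M.join
  imp := M.strongImp
  neg := M.neg
  zero := z
  one := o

end WeakAlg

/-- An algebra `⟨A, ∧, ∨, ⇒, ¬, 0, 1⟩` is an N4-lattice (presented by its strong implication) if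
`⇒` is the strong implication of an N4-lattice `⟨A, ∧, ∨, →, ¬⟩`; there is no condition on the
constants, which do not belong to the language of N4-lattices. -/
def StrongAlg.IsN4Lattice {A : Type u} (S : StrongAlg A) : Prop :=
  ∃ M : WeakAlg A, M.IsN4Lattice ∧ M.toStrong S.zero S.one = S

/-- An algebra `⟨A, ∧, ∨, ⇒, ¬, 0, 1⟩` is an N3-lattice (presented by its strong implication) if
`⇒` is the strong implication of an N3-lattice `⟨A, ∧, ∨, →, ¬⟩`, with the algebraic constants
`1 = x → x` and `0 = ¬1`. -/
def StrongAlg.IsN3Lattice {A : Type u} (S : StrongAlg A) : Prop :=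
  ∃ M : WeakAlg A, M.IsN3Lattice ∧ M.toStrong S.zero S.one = S ∧
    (∀ a : A, M.imp a a = S.one) ∧ S.zero = S.neg S.one

end Nelson

/-! Everything is read off twist structures. An N4-lattice embeds in pairs over an implicative
lattice `B` by sending `a` to `(q a, q (¬a))`, where `q` is the quotient map for `≡`. The strong
implication of two pairs has first coordinate `(q a ⇨ q b) ⊓ (q ¬b ⇨ q ¬a)` and second coordinate `q
a ⊓ q ¬b`. The N3 law says exactly that `q a ⊓ q ¬a` is the least element of `B` for every `a`.

If the algebra is also an S-algebra, then `a ⇒ a = 1` for all `a`. Comparing second coordinates, `q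
a ⊓ q ¬a` does not depend on `a`. Taking `a = 0` bounds it by `q 0`, which `0 ⇒ b = 1` puts below
everything (`IsTwistRep.inf_neg_le_of_isSAlgebra`). Conversely, when all these meets are least,
every axiom and rule of S can be checked coordinatewise (`IsTwistHom.axiom_eq_top`,
`IsTwistHom.rule_eq_top`).

The statement on logics repeats this with formulas in place of elements. A Lindenbaum quotient turns
N3, or any logic `L` above S and N4, into a pair of maps `t, f` satisfying `IsTwistHom`, where `t φ
= ⊤` means that `φ` is derivable (`LogicN3.exists_rep`, `IsLogic.exists_rep`). Soundness of S in
such pairs gives that N3 contains S; soundness of N3 in them gives that `L` contains N3. The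
construction for `L` needs weak implication, recovered from strong implication by `SFm.weakImp`. -/

namespace Nelson

/-! ### Quotients of preordered Heyting structures -/

/-- A preorder with operations that behave as those of a generalized Heyting algebra. -/
structure PreHeyting {F : Type u} (le : F → F → Prop) (inf sup imp : F → F → F) (top : F) :
    Prop where
  refl : ∀ a, le a a
  trans : ∀ {a b c}, le a b → le b c → le a c
  inf_left : ∀ a b, le (inf a b) a
  inf_right : ∀ a b, le (inf a b) b
  le_inf : ∀ {a b c}, le a b → le a c → le a (inf b c)
  le_sup_left : ∀ a b, le a (sup a b)
  le_sup_right : ∀ a b, le b (sup a b)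
  sup_le : ∀ {a b c}, le a c → le b c → le (sup a b) c
  le_top : ∀ a, le a top
  le_imp_iff : ∀ {a b c}, le a (imp b c) ↔ le (inf a b) c

/-- Identify elements that lie below each other. Residuation makes implication monotone, so all
operations descend to the quotient. This one quotient serves the Lindenbaum algebras of N4, of N3
and of an arbitrary logic above N4. -/
theorem PreHeyting.exists_rep {F : Type u} {le : F → F → Prop} {inf sup imp : F → F → F} {top : F}
    (h : PreHeyting le inf sup imp top) :
    ∃ (B : Type u) (_ : GeneralizedHeytingAlgebra B) (t : F → B), Function.Surjective t ∧
      (∀ a b, t a ≤ t b ↔ le a b) ∧ (∀ a b, t (inf a b) = t a ⊓ t b) ∧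
      (∀ a b, t (sup a b) = t a ⊔ t b) ∧ (∀ a b, t (imp a b) = t a ⇨ t b) ∧ t top = ⊤ := by
  let s : Setoid F :=
    { r := fun a b => le a b ∧ le b a
      iseqv := ⟨fun a => ⟨h.refl a, h.refl a⟩, fun h => ⟨h.2, h.1⟩,
        fun k l => ⟨h.trans k.1 l.1, h.trans l.2 k.2⟩⟩ }
  have inf_mono : ∀ {a b c d}, le a b → le c d → le (inf a c) (inf b d) := fun k l =>
    h.le_inf (h.trans (h.inf_left _ _) k) (h.trans (h.inf_right _ _) l)
  have sup_mono : ∀ {a b c d}, le a b → le c d → le (sup a c) (sup b d) := fun k l =>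
    h.sup_le (h.trans k (h.le_sup_left _ _)) (h.trans l (h.le_sup_right _ _))
  have imp_mono : ∀ {a b c d}, le b a → le c d → le (imp a c) (imp b d) := fun k l =>
    h.le_imp_iff.2 (h.trans (inf_mono (h.refl _) k) (h.trans (h.le_imp_iff.1 (h.refl _)) l))
  let A : GeneralizedHeytingAlgebra (Quotient s) :=
    { le := Quotient.lift₂ le fun a b a' b' k l => propext
        ⟨fun m => h.trans k.2 (h.trans m l.1), fun m => h.trans k.1 (h.trans m l.2)⟩
      le_refl := fun a => Quotient.inductionOn a h.refl
      le_trans := fun a b c => Quotient.inductionOn₃ a b c fun _ _ _ k l => h.trans k l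
      le_antisymm := fun a b => Quotient.inductionOn₂ a b fun _ _ k l => Quotient.sound ⟨k, l⟩
      inf := Quotient.map₂ inf fun _ _ k _ _ l => ⟨inf_mono k.1 l.1, inf_mono k.2 l.2⟩
      sup := Quotient.map₂ sup fun _ _ k _ _ l => ⟨sup_mono k.1 l.1, sup_mono k.2 l.2⟩
      himp := Quotient.map₂ imp fun _ _ k _ _ l => ⟨imp_mono k.2 l.1, imp_mono k.1 l.2⟩
      top := ⟦top⟧
      inf_le_left := fun a b => Quotient.inductionOn₂ a b h.inf_left
      inf_le_right := fun a b => Quotient.inductionOn₂ a b h.inf_right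
      le_inf := fun a b c => Quotient.inductionOn₃ a b c fun _ _ _ k l => h.le_inf k l
      le_sup_left := fun a b => Quotient.inductionOn₂ a b h.le_sup_left
      le_sup_right := fun a b => Quotient.inductionOn₂ a b h.le_sup_right
      sup_le := fun a b c => Quotient.inductionOn₃ a b c fun _ _ _ k l => h.sup_le k l
      le_top := fun a => Quotient.inductionOn a h.le_top
      le_himp_iff := fun a b c => Quotient.inductionOn₃ a b c fun _ _ _ => h.le_imp_iff }
  exact ⟨Quotient s, A, Quotient.mk s, Quotient.mk_surjective, fun _ _ => Iff.rfl,
    fun _ _ => rfl, fun _ _ => rfl, fun _ _ => rfl, rfl⟩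

/-! ### Lindenbaum algebras of axiomatic extensions of N4 -/

namespace MPDeriv

variable {Ax : NFm → Prop} {Γ Δ : Set NFm}

theorem mono {Ax' : NFm → Prop} (hA : ∀ φ, Ax φ → Ax' φ) (hΓ : Γ ⊆ Δ) {φ : NFm}
    (h : MPDeriv Ax Γ φ) : MPDeriv Ax' Δ φ := by
  induction h with
  | hyp h => exact .hyp (hΓ h)
  | ax h => exact .ax (hA _ h)
  | mp _ _ h k => exact .mp h k

theorem cut {φ : NFm} (hΔ : ∀ δ ∈ Δ, MPDeriv Ax Γ δ) (h : MPDeriv Ax Δ φ) : MPDeriv Ax Γ φ := by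
  induction h with
  | hyp h => exact hΔ _ h
  | ax h => exact .ax h
  | mp _ _ h k => exact .mp h k

theorem deduction (hA : ∀ φ, N4Axiom φ → Ax φ) {φ ψ : NFm} (h : MPDeriv Ax (insert φ Γ) ψ) :
    MPDeriv Ax Γ (φ →ⁿ ψ) := by
  have k : ∀ χ, MPDeriv Ax Γ χ → MPDeriv Ax Γ (φ →ⁿ χ) := fun χ h =>
    .mp h (.ax (hA _ (.n1 χ φ)))
  induction h with
  | hyp h =>
    rcases h with rfl | h
    -- The usual derivation of `φ → φ` from the first two axioms; the variable is an arbitrary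
    -- auxiliary formula.
    · exact .mp (.ax (hA _ (.n1 _ (.var 0)))) (.mp (.ax (hA _ (.n1 _ _)))
        (.ax (hA _ (.n2 _ (_ →ⁿ _) _))))
    · exact k _ (.hyp h)
  | ax h => exact k _ (.ax h)
  | mp _ _ h h' => exact .mp h (.mp h' (.ax (hA _ (.n2 _ _ _))))

theorem preHeyting (hA : ∀ φ, N4Axiom φ → Ax φ) (Γ : Set NFm) :
    PreHeyting (fun φ ψ => MPDeriv Ax Γ (φ →ⁿ ψ)) NFm.and NFm.or NFm.imp
      (NFm.var 0 →ⁿ NFm.var 0) := by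
  have A : ∀ {Δ : Set NFm} {φ}, N4Axiom φ → MPDeriv Ax Δ φ := fun h => .ax (hA _ h)
  have W : ∀ {φ ψ : NFm}, MPDeriv Ax Γ φ → MPDeriv Ax (insert ψ Γ) φ := fun h =>
    mono (fun _ => id) (Set.subset_insert _ _) h
  have I : ∀ {Δ : Set NFm} {φ : NFm}, MPDeriv Ax (insert φ Δ) φ := .hyp (Set.mem_insert _ _)
  have D : ∀ {Δ : Set NFm} {φ ψ : NFm}, MPDeriv Ax (insert φ Δ) ψ → MPDeriv Ax Δ (φ →ⁿ ψ) :=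
    deduction hA
  refine ⟨fun a => D I, fun h k => D (.mp (.mp I (W h)) (W k)), fun a b => A (.n3 _ _),
    fun a b => A (.n4 _ _), fun h k => .mp k (.mp h (A (.n5 _ _ _))), fun a b => A (.n6 _ _),
    fun a b => A (.n7 _ _), fun h k => .mp k (.mp h (A (.n8 _ _ _))), fun a => D (D I),
    fun {a b c} => ⟨fun h => D ?_, fun h => D (D ?_)⟩⟩
  · exact .mp (.mp I (A (.n4 _ _))) (.mp (.mp I (A (.n3 _ _))) (W h))
  · have h' : MPDeriv Ax (insert b (insert a Γ)) ((a ∧ⁿ b) →ⁿ c) :=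
      mono (fun _ => id) (Set.subset_insert _ _) (W h)
    have ha : MPDeriv Ax (insert b (insert a Γ)) a := .hyp (Set.mem_insert_of_mem _ (Set.mem_insert _ _))
    exact .mp (.mp I (.mp (D I) (.mp (D (mono (fun _ => id) (Set.subset_insert _ _) ha))
      (A (.n5 _ _ _))))) h'

/-- The Lindenbaum algebra is taken for mutual weak implication only, which negation need not
respect. Hence the class of `¬φ` is tracked as a second coordinate, governed by the De Morgan axioms
and the axiom for negated implication. -/
theorem exists_rep (hA : ∀ φ, N4Axiom φ → Ax φ) (Γ : Set NFm) :
    ∃ (B : Type) (_ : GeneralizedHeytingAlgebra B) (t : NFm → B), Function.Surjective t ∧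
      (∀ φ ψ, t φ ≤ t ψ ↔ MPDeriv Ax Γ (φ →ⁿ ψ)) ∧ (∀ φ, t φ = ⊤ ↔ MPDeriv Ax Γ φ) ∧
      (∀ φ ψ, t (φ ∧ⁿ ψ) = t φ ⊓ t ψ) ∧ (∀ φ ψ, t (φ ∨ⁿ ψ) = t φ ⊔ t ψ) ∧
      (∀ φ ψ, t (φ →ⁿ ψ) = t φ ⇨ t ψ) ∧ (∀ φ, t (¬ⁿ (¬ⁿ φ)) = t φ) ∧
      (∀ φ ψ, t (¬ⁿ (φ ∧ⁿ ψ)) = t (¬ⁿ φ) ⊔ t (¬ⁿ ψ)) ∧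
      (∀ φ ψ, t (¬ⁿ (φ ∨ⁿ ψ)) = t (¬ⁿ φ) ⊓ t (¬ⁿ ψ)) ∧
      (∀ φ ψ, t (¬ⁿ (φ →ⁿ ψ)) = t φ ⊓ t (¬ⁿ ψ)) := by
  obtain ⟨B, _, t, hs, hle, hinf, hsup, himp, -⟩ := (preHeyting hA Γ).exists_rep
  have E : ∀ {φ ψ}, N4Axiom (NFm.iff φ ψ) → t φ = t ψ := fun {φ ψ} h => by
    have h' : MPDeriv Ax Γ ((φ →ⁿ ψ) ∧ⁿ (ψ →ⁿ φ)) := .ax (hA _ h)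
    exact le_antisymm ((hle _ _).2 (.mp h' (.ax (hA _ (.n3 _ _)))))
      ((hle _ _).2 (.mp h' (.ax (hA _ (.n4 _ _)))))
  refine ⟨B, _, t, hs, hle, fun φ => ?_, hinf, hsup, himp, fun φ => E (.n9 φ), fun φ ψ => ?_,
    fun φ ψ => ?_, fun φ ψ => ?_⟩
  · have hφ : t (φ →ⁿ φ) = ⊤ := by rw [himp, himp_self]
    rw [← top_le_iff, ← hφ, hle]
    exact ⟨fun h => .mp ((preHeyting hA Γ).refl φ) h, fun h => .mp h (.ax (hA _ (.n1 _ _)))⟩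
  · rw [← hsup]; exact E (.n11 _ _)
  · rw [← hinf]; exact E (.n10 _ _)
  · rw [← hinf]; exact E (.n12 _ _)

end MPDeriv

/-! ### Twist valuations -/

/-- The pair `(t, f)` is a homomorphism from formulas to the twist structure over `B`, with values
among the pairs `(a, b)` for which `a ⊓ b` is the least element of `B`. -/
structure IsTwistHom {B : Type u} [GeneralizedHeytingAlgebra B] (t f : SFm → B) : Prop where
  t_and : ∀ φ ψ, t (φ ∧ˢ ψ) = t φ ⊓ t ψ
  f_and : ∀ φ ψ, f (φ ∧ˢ ψ) = f φ ⊔ f ψ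
  t_or : ∀ φ ψ, t (φ ∨ˢ ψ) = t φ ⊔ t ψ
  f_or : ∀ φ ψ, f (φ ∨ˢ ψ) = f φ ⊓ f ψ
  t_imp : ∀ φ ψ, t (φ ⇒ˢ ψ) = (t φ ⇨ t ψ) ⊓ (f ψ ⇨ f φ)
  f_imp : ∀ φ ψ, f (φ ⇒ˢ ψ) = t φ ⊓ f ψ
  t_neg : ∀ φ, t (¬ˢ φ) = f φ
  f_neg : ∀ φ, f (¬ˢ φ) = t φ
  t_zero : ∀ x, t SFm.zero ≤ x
  f_zero : f SFm.zero = ⊤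
  inf_le : ∀ φ x, t φ ⊓ f φ ≤ x

namespace IsTwistHom

variable {B : Type u} [GeneralizedHeytingAlgebra B] {t f : SFm → B}

theorem comp_subst (h : IsTwistHom t f) (σ : ℕ → SFm) :
    IsTwistHom (fun φ => t (φ.subst σ)) (fun φ => f (φ.subst σ)) :=
  ⟨fun _ _ => h.t_and _ _, fun _ _ => h.f_and _ _, fun _ _ => h.t_or _ _, fun _ _ => h.f_or _ _,
    fun _ _ => h.t_imp _ _, fun _ _ => h.f_imp _ _, fun _ => h.t_neg _, fun _ => h.f_neg _,
    h.t_zero, h.f_zero, fun _ => h.inf_le _⟩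

theorem imp_eq_top (h : IsTwistHom t f) {φ ψ : SFm} :
    t (φ ⇒ˢ ψ) = ⊤ ↔ t φ ≤ t ψ ∧ f ψ ≤ f φ := by
  rw [h.t_imp, inf_eq_top_iff, himp_eq_top_iff, himp_eq_top_iff]

theorem f_le_of_t_eq_top (h : IsTwistHom t f) {φ : SFm} (hφ : t φ = ⊤) (x : B) : f φ ≤ x := by
  simpa [hφ] using h.inf_le φ x

/-- Iterating `⇒` recovers weak implication in the first coordinate: under `t φ ⇨ t ψ`, the element
`t φ ⊓ f ψ` lies below `t ψ ⊓ f ψ`, which is least, so the contrapositive conditions come for free.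
-/
theorem t_imp2 (h : IsTwistHom t f) (φ ψ : SFm) : t (SFm.imp2 φ ψ) = t φ ⇨ t ψ := by
  rw [SFm.imp2, h.t_imp, h.t_imp, h.f_imp, himp_inf_distrib, himp_idem]
  refine le_antisymm (inf_le_left.trans inf_le_left)
    (le_inf (le_inf le_rfl (le_himp_iff.2 (le_himp_iff.2 ?_))) (le_himp_iff.2 ?_)) <;>
  · refine le_trans ?_ (h.inf_le ψ _)
    refine le_inf (le_trans (le_inf ?_ ?_) (himp_inf_le (a := t φ) (b := t ψ))) ?_
    · first
      | exact inf_le_left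
      | exact inf_le_left.trans inf_le_left
    · first
      | exact inf_le_right.trans inf_le_left
      | exact inf_le_left.trans inf_le_right
    · first
      | exact inf_le_right
      | exact inf_le_right.trans inf_le_right

theorem imp_mono (h : IsTwistHom t f) {γ φ ψ : SFm} (k : t φ ≤ t ψ ∧ f ψ ≤ f φ) :
    t (γ ⇒ˢ φ) ≤ t (γ ⇒ˢ ψ) ∧ f (γ ⇒ˢ ψ) ≤ f (γ ⇒ˢ φ) := by
  simp only [h.t_imp, h.f_imp]
  exact ⟨inf_le_inf (himp_le_himp_left k.1) (himp_le_himp_right k.2), inf_le_inf_left _ k.2⟩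

theorem impList_mono (h : IsTwistHom t f) (Γ : List SFm) {φ ψ : SFm}
    (k : t φ ≤ t ψ ∧ f ψ ≤ f φ) :
    t (SFm.impList Γ φ) ≤ t (SFm.impList Γ ψ) ∧ f (SFm.impList Γ ψ) ≤ f (SFm.impList Γ φ) := by
  induction Γ with
  | nil => exact k
  | cons γ Γ ih => exact h.imp_mono ih

theorem impList_eq_top (h : IsTwistHom t f) {Γ : List SFm} {φ ψ : SFm}
    (hφ : t (SFm.impList Γ φ) = ⊤) (k₁ : t φ ≤ t ψ) (k₂ : f ψ ≤ f φ) :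
    t (SFm.impList Γ ψ) = ⊤ :=
  top_le_iff.1 (hφ.ge.trans (h.impList_mono Γ ⟨k₁, k₂⟩).1)

/-- Unlike for `impList`, no comparison of the `f` values is needed, since `⇒²` depends only on `t`.
-/
theorem imp2List_mono (h : IsTwistHom t f) (Γ : List SFm) {φ ψ : SFm} (k : t φ ≤ t ψ) :
    t (SFm.imp2List Γ φ) ≤ t (SFm.imp2List Γ ψ) := by
  induction Γ with
  | nil => exact k
  | cons γ Γ ih =>
    change t (SFm.imp2 _ _) ≤ t (SFm.imp2 _ _)
    rw [h.t_imp2, h.t_imp2]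
    exact himp_le_himp_left ih

theorem impList_and (h : IsTwistHom t f) (Γ : List SFm) (φ ψ : SFm) :
    t (SFm.impList Γ (φ ∧ˢ ψ)) = t (SFm.impList Γ φ) ⊓ t (SFm.impList Γ ψ) ∧
      f (SFm.impList Γ (φ ∧ˢ ψ)) = f (SFm.impList Γ φ) ⊔ f (SFm.impList Γ ψ) := by
  induction Γ with
  | nil => exact ⟨h.t_and _ _, h.f_and _ _⟩
  | cons γ Γ ih =>
    change t (γ ⇒ˢ _) = t (γ ⇒ˢ _) ⊓ t (γ ⇒ˢ _) ∧ f (γ ⇒ˢ _) = f (γ ⇒ˢ _) ⊔ f (γ ⇒ˢ _)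
    simp only [h.t_imp, h.f_imp]
    simp only [SFm.impList] at ih ⊢
    rw [ih.1, ih.2, himp_inf_distrib, sup_himp_distrib, inf_sup_left]
    exact ⟨inf_inf_inf_comm _ _ _ _, rfl⟩

theorem axiom_eq_top (h : IsTwistHom t f) {φ : SFm} (hφ : SAxiom φ) : t φ = ⊤ := by
  cases hφ with
  | a1 φ => exact h.imp_eq_top.2 ⟨le_rfl, le_rfl⟩
  | a2 ψ => exact h.imp_eq_top.2 ⟨h.t_zero _, h.f_zero ▸ le_top⟩
  | a3 φ =>
    refine h.imp_eq_top.2 ⟨?_, ?_⟩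
    · rw [h.t_neg, h.t_imp, h.f_zero, top_himp]
      exact le_inf (le_himp_iff.2 (inf_comm (f φ) (t φ) ▸ h.inf_le φ _)) le_rfl
    · rw [h.f_imp, h.f_zero, h.f_neg, inf_top_eq]
  | a4 => exact (h.t_neg _).trans h.f_zero
  | a5 φ ψ =>
    have ht : t (φ ⇒ˢ ψ) = t (¬ˢ ψ ⇒ˢ ¬ˢ φ) := by
      simp only [h.t_imp, h.t_neg, h.f_neg, inf_comm]
    have hf : f (φ ⇒ˢ ψ) = f (¬ˢ ψ ⇒ˢ ¬ˢ φ) := by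
      simp only [h.f_imp, h.t_neg, h.f_neg, inf_comm]
    rw [SFm.iff, h.t_and, inf_eq_top_iff, h.imp_eq_top, h.imp_eq_top]
    exact ⟨⟨ht.le, hf.ge⟩, ⟨ht.ge, hf.le⟩⟩

theorem rule_eq_top (h : IsTwistHom t f) {ps : List SFm} {φ : SFm} (hr : SRule ps φ)
    (hp : ∀ ψ ∈ ps, t ψ = ⊤) : t φ = ⊤ := by
  cases hr with
  | p Γ φ ψ γ =>
    refine h.impList_eq_top (hp _ (List.mem_singleton.2 rfl)) ?_ ?_
    · simp only [h.t_imp, h.f_imp, himp_inf_distrib, himp_himp]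
      rw [inf_comm (t φ) (t ψ), inf_comm (t ψ) (f γ), inf_comm (t φ) (f γ)]
      exact le_inf (le_inf (inf_le_left.trans inf_le_left) inf_le_right)
        (inf_le_left.trans inf_le_right)
    · simp only [h.f_imp]
      exact (inf_left_comm _ _ _).le
  | c φ γ =>
    have k := hp (SFm.imp φ (SFm.imp2 φ γ)) (by simp [SFm.imp2])
    rw [h.imp_eq_top, h.t_imp2] at k
    exact (h.t_imp2 _ _).trans (himp_eq_top_iff.2 (by simpa using k.1))
  | e Γ φ γ =>
    have k := h.imp_eq_top.1 (hp (φ ⇒ˢ γ) (by simp))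
    exact h.impList_eq_top (hp (SFm.impList Γ φ) (by simp)) k.1 k.2
  | impL Γ φ ψ γ =>
    have k := h.imp_eq_top.1 (hp (ψ ⇒ˢ γ) (by simp))
    refine h.impList_eq_top (hp (SFm.impList Γ φ) (by simp)) ?_ ?_
    · simp only [h.t_imp, h.f_imp]
      refine le_inf (le_himp_iff.2 ?_) (le_himp_iff.2 (inf_le_inf_left _ k.2))
      exact (inf_le_inf_left _ inf_le_left).trans (inf_himp_le.trans k.1)
    · simp only [h.t_imp, h.f_imp]
      exact (inf_le_inf inf_le_right k.2).trans himp_inf_le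
  | impR φ γ =>
    have k := hp γ (by simp)
    exact h.imp_eq_top.2 ⟨k ▸ le_top, h.f_le_of_t_eq_top k _⟩
  | andL1 φ ψ γ =>
    have k := h.imp_eq_top.1 (hp (φ ⇒ˢ γ) (by simp))
    rw [h.imp_eq_top, h.t_and, h.f_and]
    exact ⟨inf_le_left.trans k.1, k.2.trans le_sup_left⟩
  | andL2 φ ψ γ =>
    have k := h.imp_eq_top.1 (hp (ψ ⇒ˢ γ) (by simp))
    rw [h.imp_eq_top, h.t_and, h.f_and]
    exact ⟨inf_le_right.trans k.1, k.2.trans le_sup_right⟩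
  | andR Γ φ ψ =>
    rw [(h.impList_and Γ φ ψ).1, hp _ (by simp), hp (SFm.impList Γ ψ) (by simp), inf_top_eq]
  | orL1 φ ψ γ =>
    have k := h.imp_eq_top.1 (hp (φ ⇒ˢ γ) (by simp))
    have l := h.imp_eq_top.1 (hp (ψ ⇒ˢ γ) (by simp))
    rw [h.imp_eq_top, h.t_or, h.f_or]
    exact ⟨sup_le k.1 l.1, le_inf k.2 l.2⟩
  | orL2 φ ψ γ =>
    have k := hp (SFm.imp2 φ γ) (by simp)
    have l := hp (SFm.imp2 ψ γ) (by simp)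
    rw [h.t_imp2, himp_eq_top_iff] at k l ⊢
    rw [h.t_or]
    exact sup_le k l
  | orR1 Γ φ ψ =>
    refine h.impList_eq_top (hp (SFm.impList Γ φ) (by simp)) ?_ ?_
    · rw [h.t_or]; exact le_sup_left
    · rw [h.f_or]; exact inf_le_left
  | orR2 Γ φ ψ =>
    refine h.impList_eq_top (hp (SFm.impList Γ ψ) (by simp)) ?_ ?_
    · rw [h.t_or]; exact le_sup_right
    · rw [h.f_or]; exact inf_le_right
  | negImpL φ ψ γ =>
    have k := h.imp_eq_top.1 (hp ((φ ∧ˢ ¬ˢ ψ) ⇒ˢ γ) (by simp))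
    rw [h.t_and, h.f_and, h.t_neg, h.f_neg] at k
    rw [h.imp_eq_top, h.t_neg, h.f_neg, h.f_imp, h.t_imp]
    -- It remains to see `f φ ⊔ t ψ ≤ t (φ ⇒ ψ)`; two of the four inequalities use that `t ⊓ f` is
    -- least.
    refine ⟨k.1, k.2.trans (sup_le (le_inf ?_ ?_) (le_inf ?_ ?_))⟩
    · exact le_himp_iff.2 (inf_comm (f φ) (t φ) ▸ h.inf_le φ _)
    · exact le_himp
    · exact le_himp
    · exact le_himp_iff.2 (h.inf_le ψ _)
  | negImpR Γ φ ψ =>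
    -- `φ ∧ ¬ψ` and `¬(φ ⇒ ψ)` agree under `t` but in general not under `f`; this is why the rule is
    -- stated with `⇒²`.
    refine top_le_iff.1 ((hp _ (List.mem_singleton.2 rfl)).ge.trans (h.imp2List_mono Γ ?_))
    rw [h.t_and, h.t_neg, h.t_neg, h.f_imp]
  | negAndL φ ψ γ =>
    have k := h.imp_eq_top.1 (hp ((¬ˢ φ ∨ˢ ¬ˢ ψ) ⇒ˢ γ) (by simp))
    simpa only [h.imp_eq_top, h.t_and, h.f_and, h.t_or, h.f_or, h.t_neg, h.f_neg] using k
  | negAndR Γ φ ψ =>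
    refine h.impList_eq_top (hp _ (List.mem_singleton.2 rfl)) ?_ ?_ <;>
    simp only [h.t_and, h.f_and, h.t_or, h.f_or, h.t_neg, h.f_neg, le_refl]
  | negOrL φ ψ γ =>
    have k := h.imp_eq_top.1 (hp ((¬ˢ φ ∧ˢ ¬ˢ ψ) ⇒ˢ γ) (by simp))
    simpa only [h.imp_eq_top, h.t_and, h.f_and, h.t_or, h.f_or, h.t_neg, h.f_neg] using k
  | negOrR Γ φ ψ =>
    refine h.impList_eq_top (hp _ (List.mem_singleton.2 rfl)) ?_ ?_ <;>
    simp only [h.t_and, h.f_and, h.t_or, h.f_or, h.t_neg, h.f_neg, le_refl]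
  | negNegL φ γ =>
    have k := h.imp_eq_top.1 (hp (φ ⇒ˢ γ) (by simp))
    simpa only [h.imp_eq_top, h.t_neg, h.f_neg] using k
  | negNegR Γ φ =>
    refine h.impList_eq_top (hp _ (List.mem_singleton.2 rfl)) ?_ ?_ <;> simp only [h.t_neg, h.f_neg, le_refl]

end IsTwistHom

/-! ### Twist semantics of the weak implication language -/

/-- The value of a formula in the twist structure over `B`. -/
def NFm.twist {B : Type u} [GeneralizedHeytingAlgebra B] (v : ℕ → B × B) : NFm → B × B
  | .var n => v n
  | .and φ ψ => ((φ.twist v).1 ⊓ (ψ.twist v).1, (φ.twist v).2 ⊔ (ψ.twist v).2)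
  | .or φ ψ => ((φ.twist v).1 ⊔ (ψ.twist v).1, (φ.twist v).2 ⊓ (ψ.twist v).2)
  | .imp φ ψ => ((φ.twist v).1 ⇨ (ψ.twist v).1, (φ.twist v).1 ⊓ (ψ.twist v).2)
  | .neg φ => ((φ.twist v).2, (φ.twist v).1)

section
variable {B : Type u} [GeneralizedHeytingAlgebra B]

theorem NFm.twist_strongImp (v : ℕ → B × B) (φ ψ : NFm) :
    (NFm.strongImp φ ψ).twist v =
      (((φ.twist v).1 ⇨ (ψ.twist v).1) ⊓ ((ψ.twist v).2 ⇨ (φ.twist v).2),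
        (φ.twist v).1 ⊓ (ψ.twist v).2) := by
  simp [NFm.strongImp, NFm.twist, inf_comm]

/-- Pairs whose coordinates meet in the least element are closed under the twist operations, so only
variables need the hypothesis. -/
theorem NFm.twist_inf_le {v : ℕ → B × B} (hv : ∀ n x, (v n).1 ⊓ (v n).2 ≤ x) (φ : NFm) (x : B) :
    (φ.twist v).1 ⊓ (φ.twist v).2 ≤ x := by
  induction φ generalizing x with
  | var n => exact hv n x
  | and φ ψ h k =>
    simp only [NFm.twist, inf_sup_left]
    exact sup_le ((inf_le_inf_right _ inf_le_left).trans (h x))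
      ((inf_le_inf_right _ inf_le_right).trans (k x))
  | or φ ψ h k =>
    simp only [NFm.twist, inf_sup_right]
    exact sup_le ((inf_le_inf_left _ inf_le_left).trans (h x))
      ((inf_le_inf_left _ inf_le_right).trans (k x))
  | imp φ ψ h k =>
    simp only [NFm.twist, ← inf_assoc]
    exact (inf_le_inf_right _ himp_inf_le).trans (k x)
  | neg φ h =>
    simp only [NFm.twist]
    rw [inf_comm]
    exact h x

theorem N4Axiom.twist_eq_top (v : ℕ → B × B) {φ : NFm} (h : N4Axiom φ) : (φ.twist v).1 = ⊤ := by
  cases h <;> simp only [NFm.iff, NFm.twist, himp_eq_top_iff, himp_self, inf_top_eq]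
  case n1 => exact le_himp
  case n2 φ ψ γ =>
    refine le_himp_iff.2 (le_himp_iff.2 ?_)
    refine le_trans (le_inf (le_trans (inf_le_inf_right _ inf_le_left) himp_inf_le)
      (le_trans (inf_le_inf_right _ inf_le_right) himp_inf_le)) himp_inf_le
  case n3 => exact inf_le_left
  case n4 => exact inf_le_right
  case n5 => rw [himp_inf_distrib, le_himp_iff]
  case n6 => exact le_sup_left
  case n7 => exact le_sup_right
  case n8 => rw [sup_himp_distrib, le_himp_iff]

theorem LogicN3.twist_eq_top {v : ℕ → B × B} (hv : ∀ n x, (v n).1 ⊓ (v n).2 ≤ x) {Γ : Set NFm}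
    (hΓ : ∀ γ ∈ Γ, (γ.twist v).1 = ⊤) {φ : NFm} (h : LogicN3 Γ φ) : (φ.twist v).1 = ⊤ := by
  induction h with
  | hyp h => exact hΓ _ h
  | ax h =>
    cases h with
    | ofN4 h => exact h.twist_eq_top v
    | n13 φ ψ =>
      simp only [NFm.twist, himp_eq_top_iff, le_himp_iff]
      rw [inf_comm]
      exact NFm.twist_inf_le hv φ _
  | mp _ _ h k =>
    simp only [NFm.twist, h, top_himp] at k
    exact k

/-- A twist valuation sends a formula to the value of its translation. -/
theorem IsTwistHom.twist_toN {t f : SFm → B} (h : IsTwistHom t f) (φ : SFm) :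
    φ.toN.twist (fun n => (t (.var n), f (.var n))) = (t φ, f φ) := by
  induction φ with
  | var n => rfl
  | and φ ψ hφ hψ => simp only [SFm.toN, NFm.twist, hφ, hψ, h.t_and, h.f_and]
  | or φ ψ hφ hψ => simp only [SFm.toN, NFm.twist, hφ, hψ, h.t_or, h.f_or]
  | imp φ ψ hφ hψ => simp only [SFm.toN, NFm.twist_strongImp, hφ, hψ, h.t_imp, h.f_imp]
  | neg φ hφ => simp only [SFm.toN, NFm.twist, hφ, h.t_neg, h.f_neg]
  | zero =>
    simp only [SFm.toN, NFm.twist, himp_self, h.f_zero]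
    -- `0` translates to `¬(p → p)`, with first coordinate `t p ⊓ f p`; this and `t 0` are both
    -- least.
    rw [le_antisymm (h.inf_le _ _) (h.t_zero _)]

theorem IsTwistHom.strongN3_eq_top {t f : SFm → B} (h : IsTwistHom t f) {Γ : Set SFm} {φ : SFm}
    (hφ : StrongN3 Γ φ) (hΓ : ∀ γ ∈ Γ, t γ = ⊤) : t φ = ⊤ := by
  have k := LogicN3.twist_eq_top (v := fun n => (t (.var n), f (.var n)))
    (fun n => h.inf_le _) (fun γ hγ => ?_) hφ
  · rwa [h.twist_toN] at k
  · obtain ⟨γ, hγ, rfl⟩ := hγ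
    rw [h.twist_toN]
    exact hΓ _ hγ

end

/-! ### Twist representation of N4-lattices -/

/-- An implicative lattice as a generalized Heyting algebra. -/
theorem IsImplicativeLattice.exists_generalizedHeytingAlgebra {B : Type u}
    {meet join imp : B → B → B} (h : IsImplicativeLattice meet join imp) :
    ∃ _ : GeneralizedHeytingAlgebra B, (∀ a b, a ⊓ b = meet a b) ∧ (∀ a b, a ⊔ b = join a b) ∧
      ∀ a b, a ⇨ b = imp a b := by
  obtain ⟨l, ⟨top, htop⟩, hr⟩ := h
  have idem : ∀ a, meet a a = a := fun a => by
    have k := l.meet_join_absorb a (meet a a)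
    rwa [l.join_meet_absorb] at k
  have join_iff : ∀ a b, meet a b = a ↔ join a b = b := fun a b =>
    ⟨fun k => by rw [← k, l.join_comm, l.meet_comm, l.join_meet_absorb],
      fun k => by rw [← k, l.meet_join_absorb]⟩
  refine ⟨
    { le := fun a b => meet a b = a
      le_refl := idem
      le_trans := fun a b c k m => by
        change meet a b = a at k
        change meet b c = b at m
        rw [← k, l.meet_assoc, m]
      le_antisymm := fun a b k m => by
        change meet a b = a at k
        change meet b a = b at m
        rw [← k, l.meet_comm, m]
      inf := meet
      sup := join
      himp := imp
      top := top
      inf_le_left := fun a b => by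
        rw [l.meet_comm, ← l.meet_assoc, idem]
      inf_le_right := fun a b => by
        rw [l.meet_assoc, idem]
      le_inf := fun a b c k m => by
        change meet a b = a at k
        change meet a c = a at m
        rw [← l.meet_assoc, k, m]
      le_sup_left := l.meet_join_absorb
      le_sup_right := fun a b => by
        rw [l.join_comm, l.meet_join_absorb]
      sup_le := fun a b c k m => by
        change meet a c = a at k
        change meet b c = b at m
        rw [join_iff] at k m ⊢
        rw [l.join_assoc, m, k]
      le_top := htop
      le_himp_iff := fun a b c => (hr a b c).symm }, fun _ _ => rfl, fun _ _ => rfl, fun _ _ => rfl⟩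

namespace WeakAlg
variable {A : Type u} {M : WeakAlg A}

/-- An embedding of `M` in the twist structure over `B`, `a ↦ (q a, q (¬a))`. -/
structure IsTwistRep (M : WeakAlg A) {B : Type u} [GeneralizedHeytingAlgebra B] (q : A → B) :
    Prop where
  surjective : Function.Surjective q
  meet : ∀ a b, q (M.meet a b) = q a ⊓ q b
  join : ∀ a b, q (M.join a b) = q a ⊔ q b
  imp : ∀ a b, q (M.imp a b) = q a ⇨ q b
  neg_neg : ∀ a, q (M.neg (M.neg a)) = q a
  neg_meet : ∀ a b, q (M.neg (M.meet a b)) = q (M.neg a) ⊔ q (M.neg b)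
  neg_join : ∀ a b, q (M.neg (M.join a b)) = q (M.neg a) ⊓ q (M.neg b)
  neg_imp : ∀ a b, q (M.neg (M.imp a b)) = q a ⊓ q (M.neg b)
  ext : ∀ a b, q a = q b → q (M.neg a) = q (M.neg b) → a = b

/-- Take `q` to be the quotient map for `≡`. The pair `(q a, q (¬a))` determines `a` because the
lattice order is `≼` together with reversed `≼` on negations. -/
theorem IsN4Lattice.exists_rep (h : M.IsN4Lattice) :
    ∃ (B : Type u) (_ : GeneralizedHeytingAlgebra B) (q : A → B), M.IsTwistRep q := by
  obtain ⟨H, hinf, hsup, himp⟩ := h.quotient.exists_generalizedHeytingAlgebra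
  let s := M.equivSetoid h.prec_refl h.prec_trans
  have E : ∀ {a b : A}, M.equiv a b → (Quotient.mk s a) = Quotient.mk s b := fun k =>
    Quotient.sound k
  have X : ∀ {a b : A}, (Quotient.mk s a) = Quotient.mk s b → M.equiv a b := fun k =>
    Quotient.exact k
  have d := h.deMorgan
  refine ⟨_, H, Quotient.mk s, Quotient.mk_surjective, fun a b => (hinf (Quotient.mk s a) (Quotient.mk s b)).symm,
    fun a b => (hsup (Quotient.mk s a) (Quotient.mk s b)).symm,
    fun a b => (himp (Quotient.mk s a) (Quotient.mk s b)).symm, fun a => by rw [d.neg_neg],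
    fun a b => ?_, fun a b => ?_, fun a b => ?_, fun a b k l => ?_⟩
  · rw [d.neg_meet]; exact (hsup (Quotient.mk s (M.neg a)) (Quotient.mk s (M.neg b))).symm
  · rw [d.neg_join]; exact (hinf (Quotient.mk s (M.neg a)) (Quotient.mk s (M.neg b))).symm
  · exact (E (h.neg_imp a b)).trans (hinf (Quotient.mk s a) (Quotient.mk s (M.neg b))).symm
  · have k := X k
    have l := X l
    have h₁ : M.meet a b = a := (h.le_iff a b).2 ⟨k.1, l.2⟩
    have h₂ : M.meet b a = b := (h.le_iff b a).2 ⟨k.2, l.1⟩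
    rw [← h₁, d.lattice.meet_comm, h₂]

namespace IsTwistRep
variable {B : Type u} [GeneralizedHeytingAlgebra B] {q : A → B}

theorem strongImp (h : M.IsTwistRep q) (a b : A) :
    q (M.strongImp a b) = (q a ⇨ q b) ⊓ (q (M.neg b) ⇨ q (M.neg a)) := by
  rw [WeakAlg.strongImp, h.meet, h.imp, h.imp]

theorem neg_strongImp (h : M.IsTwistRep q) (a b : A) :
    q (M.neg (M.strongImp a b)) = q a ⊓ q (M.neg b) := by
  rw [WeakAlg.strongImp, h.neg_meet, h.neg_imp, h.neg_imp, h.neg_neg, inf_comm (q (M.neg b)),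
    sup_idem]

/-- Under `q`, the explosion law becomes `q (¬a) ≤ q a ⇨ q b`, with `q b` arbitrary by surjectivity.
-/
theorem inf_neg_le (h : M.IsTwistRep q) (hM : M.IsN3Lattice) (a : A) (x : B) :
    q a ⊓ q (M.neg a) ≤ x := by
  obtain ⟨b, rfl⟩ := h.surjective x
  have k := congrArg q (hM.explosion a b)
  rw [h.imp, h.imp, h.imp, himp_self, himp_eq_top_iff, le_himp_iff] at k
  rwa [inf_comm]

theorem explosion (h : M.IsTwistRep q) (hq : ∀ a x, q a ⊓ q (M.neg a) ≤ x) (a b : A) :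
    M.imp (M.neg a) (M.imp a b) = M.imp a a := by
  refine h.ext _ _ ?_ ?_
  · rw [h.imp, h.imp, h.imp, himp_self, himp_eq_top_iff, le_himp_iff, inf_comm]
    exact hq a _
  · rw [h.neg_imp, h.neg_imp, h.neg_imp, ← inf_assoc, inf_comm (q (M.neg a))]
    exact le_antisymm (inf_le_left.trans (hq a _)) (hq a _)

/-- The decisive use of S: `a ⇒ a = 1` makes `q a ⊓ q ¬a` constant, its value at `a = 0` is at most
`q 0`, and `0 ⇒ b = 1` makes `q 0` least. -/
theorem inf_neg_le_of_isSAlgebra (h : M.IsTwistRep q) {z o : A}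
    (hS : (M.toStrong z o).IsSAlgebra) (a : A) (x : B) : q a ⊓ q (M.neg a) ≤ x := by
  have hself : ∀ b, q b ⊓ q (M.neg b) = q (M.neg o) := fun b => by
    rw [← h.neg_strongImp]
    exact congrArg (fun c => q (M.neg c)) (hS.imp_self b)
  have ho : q o = ⊤ := by
    have k : M.strongImp o o = o := hS.imp_self o
    rw [← k, h.strongImp, himp_self, himp_self, inf_top_eq]
  obtain ⟨b, rfl⟩ := h.surjective x
  have hz : M.strongImp z b = o := by
    simpa [StrongAlg.eval, toStrong] using
      hS.axiom_eq (fun n => if n = 0 then b else z) _ (SAxiom.a2 (SFm.var 0))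
  have k := congrArg q hz
  rw [h.strongImp, ho, inf_eq_top_iff, himp_eq_top_iff] at k
  rw [hself, ← hself z]
  exact inf_le_left.trans k.1

theorem isTwistHom (h : M.IsTwistRep q) (hq : ∀ a x, q a ⊓ q (M.neg a) ≤ x) {z o : A}
    (hz : M.neg z = o) (ho : q o = ⊤) (v : ℕ → A) :
    IsTwistHom (fun φ => q ((M.toStrong z o).eval v φ))
      (fun φ => q (M.neg ((M.toStrong z o).eval v φ))) where
  t_and _ _ := h.meet _ _
  f_and _ _ := h.neg_meet _ _
  t_or _ _ := h.join _ _
  f_or _ _ := h.neg_join _ _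
  t_imp _ _ := h.strongImp _ _
  f_imp _ _ := h.neg_strongImp _ _
  t_neg _ := rfl
  f_neg _ := h.neg_neg _
  t_zero x := by
    have k := hq z x
    rwa [hz, ho, inf_top_eq] at k
  f_zero := (congrArg q hz).trans ho
  inf_le _ := hq _

theorem isSAlgebra (h : M.IsTwistRep q) (hq : ∀ a x, q a ⊓ q (M.neg a) ≤ x) {z o : A}
    (hz : M.neg z = o) (ho : q o = ⊤) : (M.toStrong z o).IsSAlgebra := by
  -- If `q a` is the top then `q (¬a)` is least, so the first coordinate alone decides whether an
  -- element equals `1`. Equations `φ ≈ 1` thus reduce to `t φ = ⊤`.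
  have hone : ∀ a, q a = ⊤ → a = o := fun a ha => by
    refine h.ext _ _ (ha.trans ho.symm) (le_antisymm ?_ ?_)
    · simpa [ha] using hq a (q (M.neg o))
    · simpa [ho] using hq o (q (M.neg a))
  refine ⟨fun v φ hφ => hone _ ((h.isTwistHom hq hz ho v).axiom_eq_top hφ), fun a => hone _ ?_,
    fun v ps φ hr hp => hone _ ((h.isTwistHom hq hz ho v).rule_eq_top hr fun ψ hψ => ?_),
    fun a b k l => ?_⟩
  · exact (h.strongImp a a).trans (by simp)
  · exact (congrArg q (hp ψ hψ)).trans ho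
  · have k : q (M.strongImp a b) = ⊤ := (congrArg q k).trans ho
    have l : q (M.strongImp b a) = ⊤ := (congrArg q l).trans ho
    rw [h.strongImp, inf_eq_top_iff, himp_eq_top_iff, himp_eq_top_iff] at k l
    exact h.ext _ _ (le_antisymm k.1 l.1) (le_antisymm l.2 k.2)

end IsTwistRep

/-! ### N3-lattices as the N4-lattices that are S-algebras -/

theorem isN3Lattice_iff [Nonempty A] :
    M.IsN3Lattice ↔ (∃ z o : A, (M.toStrong z o).IsSAlgebra) ∧ M.IsN4Lattice := by
  constructor
  · intro hM
    obtain ⟨B, _, q, h⟩ := hM.isN4.exists_rep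
    obtain ⟨a⟩ := ‹Nonempty A›
    refine ⟨⟨M.neg (M.imp a a), M.imp a a, h.isSAlgebra (h.inf_neg_le hM)
      (hM.isN4.deMorgan.neg_neg _) ?_⟩, hM.isN4⟩
    rw [h.imp, himp_self]
  · rintro ⟨⟨z, o, hS⟩, hM⟩
    obtain ⟨B, _, q, h⟩ := hM.exists_rep
    exact ⟨hM, h.explosion (h.inf_neg_le_of_isSAlgebra hS)⟩

end WeakAlg

theorem StrongAlg.isN3Lattice_iff {A : Type u} {S : StrongAlg A} :
    S.IsN3Lattice ↔ S.IsSAlgebra ∧ S.IsN4Lattice := by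
  constructor
  · rintro ⟨M, hM, hS, hone, hzero⟩
    obtain ⟨B, _, q, h⟩ := hM.isN4.exists_rep
    have hneg : S.neg = M.neg := by rw [← hS]; rfl
    refine ⟨?_, M, hM.isN4, hS⟩
    rw [← hS]
    refine h.isSAlgebra (h.inf_neg_le hM) ?_ ?_
    · rw [hzero, hneg, hM.isN4.deMorgan.neg_neg]
    · rw [← hone S.one, h.imp, himp_self]
  · rintro ⟨hS, M, hM, hMS⟩
    obtain ⟨B, _, q, h⟩ := hM.exists_rep
    have hneg : S.neg = M.neg := by rw [← hMS]; rfl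
    have hS' : (M.toStrong S.zero S.one).IsSAlgebra := hMS.symm ▸ hS
    have hq := h.inf_neg_le_of_isSAlgebra hS'
    have hself : ∀ a, M.strongImp a a = S.one := hS'.imp_self
    refine ⟨M, ⟨hM, h.explosion hq⟩, hMS, fun a => ?_, ?_⟩
    -- `a → a` and `a ⇒ a` have the same coordinates, `⊤` and `q a ⊓ q ¬a`.
    · rw [← hself a]
      refine h.ext _ _ ?_ ?_
      · rw [h.imp, h.strongImp, himp_self, himp_self, inf_top_eq]
      · rw [h.neg_imp, h.neg_strongImp]
    · have k : S.neg S.zero = S.one := hS.axiom_eq (fun _ => S.zero) _ .a4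
      rw [← k, hneg, hM.deMorgan.neg_neg]

/-! ### The strong implication language: N3 and its least upper bound property -/

theorem LogicN3.exists_rep (Γ : Set SFm) :
    ∃ (B : Type) (_ : GeneralizedHeytingAlgebra B) (t f : SFm → B), IsTwistHom t f ∧
      ∀ φ, t φ = ⊤ ↔ StrongN3 Γ φ := by
  obtain ⟨B, _, t, hs, hle, htop, hand, hor, himp, hnn, hna, hno, hni⟩ :=
    MPDeriv.exists_rep (Ax := N3Axiom) (fun _ => .ofN4) (SFm.toN '' Γ)
  have hbot : ∀ φ x, t φ ⊓ t (¬ⁿ φ) ≤ x := fun φ x => by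
    obtain ⟨ψ, rfl⟩ := hs x
    rw [inf_comm, ← le_himp_iff, ← himp, hle]
    exact .ax (.n13 φ ψ)
  refine ⟨B, _, fun φ => t φ.toN, fun φ => t (¬ⁿ φ.toN), ?_, fun φ => htop _⟩
  refine ⟨fun _ _ => hand _ _, fun _ _ => hna _ _, fun _ _ => hor _ _, fun _ _ => hno _ _,
    fun φ ψ => ?_, fun φ ψ => ?_, fun _ => rfl, fun _ => hnn _, fun x => ?_, ?_, fun _ => hbot _⟩
  · simp only [SFm.toN, NFm.strongImp, hand, himp]
  · simp only [SFm.toN, NFm.strongImp, hna, hni, hnn]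
    rw [inf_comm (t (¬ⁿ ψ.toN)), sup_idem]
  · simp only [SFm.toN, hni]
    exact hbot _ _
  · simp only [SFm.toN, hnn, himp, himp_self]

theorem StrongN3.isLogic : IsLogic StrongN3 where
  refl Γ φ h := .hyp (Set.mem_image_of_mem _ h)
  mono Γ Δ φ h k := MPDeriv.mono (fun _ => id) (Set.image_mono h) k
  cut Γ Δ φ h k := MPDeriv.cut (by rintro _ ⟨δ, hδ, rfl⟩; exact h δ hδ) k
  subst Γ φ σ h := by
    -- Substitution does not commute with the translation, because `0` becomes a formula containing
    -- a variable. The argument is therefore semantic: a twist valuation composed with `σ` is again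
    -- one.
    obtain ⟨B, _, t, f, ht, htop⟩ := LogicN3.exists_rep (SFm.subst σ '' Γ)
    rw [← htop]
    refine (ht.comp_subst σ).strongN3_eq_top h fun γ hγ => (htop _).2 ?_
    exact .hyp (Set.mem_image_of_mem _ (Set.mem_image_of_mem _ hγ))

theorem LogicS.strongN3 {Γ : Set SFm} {φ : SFm} (h : LogicS Γ φ) : StrongN3 Γ φ := by
  obtain ⟨B, _, t, f, ht, htop⟩ := LogicN3.exists_rep Γ
  rw [← htop]
  induction h with
  | hyp h => exact (htop _).2 (.hyp (Set.mem_image_of_mem _ h))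
  | ax h => exact ht.axiom_eq_top h
  | rule hr _ ih => exact ht.rule_eq_top hr ih

theorem StrongN4.strongN3 {Γ : Set SFm} {φ : SFm} (h : StrongN4 Γ φ) : StrongN3 Γ φ :=
  MPDeriv.mono (fun _ => .ofN4) le_rfl h.2.2

/-- An inference that is valid in all twist structures is derivable in N4. -/
theorem StrongN4.of_twist {Γ : Set SFm} {φ : SFm} (hΓ : ∀ γ ∈ Γ, γ.ConstFree) (hφ : φ.ConstFree)
    (h : ∀ (B : Type) [GeneralizedHeytingAlgebra B] (v : ℕ → B × B),
      (∀ γ ∈ Γ, (γ.toN.twist v).1 = ⊤) → (φ.toN.twist v).1 = ⊤) : StrongN4 Γ φ := by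
  obtain ⟨B, _, t, hs, hle, htop, hand, hor, himp, hnn, hna, hno, hni⟩ :=
    MPDeriv.exists_rep (Ax := N4Axiom) (fun _ => id) (SFm.toN '' Γ)
  have hv : ∀ ψ : NFm, ψ.twist (fun n => (t (.var n), t (¬ⁿ (.var n)))) = (t ψ, t (¬ⁿ ψ)) := by
    intro ψ
    induction ψ with
    | var n => rfl
    | and φ ψ k l => simp only [NFm.twist, k, l, hand, hna]
    | or φ ψ k l => simp only [NFm.twist, k, l, hor, hno]
    | imp φ ψ k l => simp only [NFm.twist, k, l, himp, hni]
    | neg φ k => simp only [NFm.twist, k, hnn]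
  have k := h B (fun n => (t (.var n), t (¬ⁿ (.var n)))) fun γ hγ => ?_
  · rw [hv, htop] at k
    exact ⟨hΓ, hφ, k⟩
  · rw [hv, htop]
    exact .hyp (Set.mem_image_of_mem _ hγ)

/-- Weak implication in terms of strong implication. -/
def SFm.weakImp (φ ψ : SFm) : SFm := SFm.imp2 (φ ∧ˢ (ψ ⇒ˢ ψ)) ψ

theorem SFm.twist_weakImp {B : Type u} [GeneralizedHeytingAlgebra B] (v : ℕ → B × B)
    (φ ψ : SFm) : ((φ.weakImp ψ).toN.twist v).1 = (φ.toN.twist v).1 ⇨ (ψ.toN.twist v).1 := by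
  simp only [SFm.weakImp, SFm.imp2, SFm.toN, NFm.twist_strongImp, NFm.twist, himp_self,
    inf_top_eq, himp_inf_distrib, himp_idem]
  refine le_antisymm (inf_le_left.trans inf_le_left)
    (le_inf (le_inf le_rfl ?_) ?_) <;> rw [le_himp_iff]
  · rw [le_himp_iff]
    -- The conjunct `ψ ⇒ ψ` in `weakImp` adds the meet of the two coordinates of `ψ` to the second
    -- coordinate of the antecedent. That is what is needed here, since in N4 this meet need not be
    -- least.
    refine le_sup_of_le_right (le_inf ?_ inf_le_right)
    exact (inf_le_left (b := (ψ.toN.twist v).2)).trans himp_inf_le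
  · refine le_sup_of_le_right (le_inf ?_ (inf_le_right.trans inf_le_right))
    exact (inf_le_inf_left _ inf_le_left).trans himp_inf_le

/-! ### Logics above N4 and above S -/

namespace IsLogic
variable {L : Set SFm → SFm → Prop}

/-- The substitution by three formulas. -/
def subst₃ (φ ψ χ : SFm) : ℕ → SFm
  | 0 => φ
  | 1 => ψ
  | _ => χ

/-- Substitution instances of inferences valid in all twist structures hold in strengthenings of
N4. -/
theorem of_twist (hL : IsLogic L) (h4 : StrongN4 ≤ L) (φ ψ χ : SFm) (ps : List SFm) (c : SFm)
    (hps : ∀ p ∈ ps, p.ConstFree) (hc : c.ConstFree)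
    (h : ∀ (B : Type) [GeneralizedHeytingAlgebra B] (v : ℕ → B × B),
      (∀ p ∈ ps, (p.toN.twist v).1 = ⊤) → (c.toN.twist v).1 = ⊤) {Γ : Set SFm}
    (hΓ : ∀ p ∈ ps, L Γ (p.subst (subst₃ φ ψ χ))) : L Γ (c.subst (subst₃ φ ψ χ)) := by
  refine hL.cut Γ _ _ ?_ (hL.subst {p | p ∈ ps} c _ (h4 _ _ (StrongN4.of_twist hps hc h)))
  rintro _ ⟨p, hp, rfl⟩
  exact hΓ p hp

/-- Each law is a substitution instance of an inference in at most three variables, whose validity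
in twist structures is a Heyting computation on first coordinates. -/
theorem preHeyting (hL : IsLogic L) (h4 : StrongN4 ≤ L) (Γ : Set SFm) :
    PreHeyting (fun φ ψ => L Γ (φ.weakImp ψ)) SFm.and SFm.or SFm.weakImp
      (SFm.var 0 ⇒ˢ SFm.var 0) := by
  let x : SFm := .var 0
  let y : SFm := .var 1
  let z : SFm := .var 2
  have h0 : ∀ {φ ψ χ : SFm}, ∀ p ∈ ([] : List SFm), L Γ (p.subst (subst₃ φ ψ χ)) := by simp
  have h1 : ∀ {φ ψ χ p : SFm}, L Γ (p.subst (subst₃ φ ψ χ)) →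
      ∀ r ∈ ([p] : List SFm), L Γ (r.subst (subst₃ φ ψ χ)) := by simp
  have h2 : ∀ {φ ψ χ p q : SFm}, L Γ (p.subst (subst₃ φ ψ χ)) → L Γ (q.subst (subst₃ φ ψ χ)) →
      ∀ r ∈ ([p, q] : List SFm), L Γ (r.subst (subst₃ φ ψ χ)) := by simp +contextual
  refine ⟨fun a => hL.of_twist h4 a a a [] (x.weakImp x) ?_ ?_ ?_ h0,
    fun {a b c} k l => hL.of_twist h4 a b c [x.weakImp y, y.weakImp z] (x.weakImp z)
      ?_ ?_ ?_ (h2 k l),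
    fun a b => hL.of_twist h4 a b b [] ((x ∧ˢ y).weakImp x) ?_ ?_ ?_ h0,
    fun a b => hL.of_twist h4 a b b [] ((x ∧ˢ y).weakImp y) ?_ ?_ ?_ h0,
    fun {a b c} k l => hL.of_twist h4 a b c [x.weakImp y, x.weakImp z] (x.weakImp (y ∧ˢ z))
      ?_ ?_ ?_ (h2 k l),
    fun a b => hL.of_twist h4 a b b [] (x.weakImp (x ∨ˢ y)) ?_ ?_ ?_ h0,
    fun a b => hL.of_twist h4 a b b [] (y.weakImp (x ∨ˢ y)) ?_ ?_ ?_ h0,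
    fun {a b c} k l => hL.of_twist h4 a b c [x.weakImp z, y.weakImp z] ((x ∨ˢ y).weakImp z)
      ?_ ?_ ?_ (h2 k l),
    -- The second formula is `.var 0` so that `y ⇒ y` becomes the chosen top element.
    fun a => hL.of_twist h4 a (.var 0) a [] (x.weakImp (y ⇒ˢ y)) ?_ ?_ ?_ h0,
    fun {a b c} => ⟨fun k => hL.of_twist h4 a b c [x.weakImp (y.weakImp z)]
      ((x ∧ˢ y).weakImp z) ?_ ?_ ?_ (h1 k),
    fun k => hL.of_twist h4 a b c [(x ∧ˢ y).weakImp z] (x.weakImp (y.weakImp z))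
      ?_ ?_ ?_ (h1 k)⟩⟩
  all_goals first
    | (simp [SFm.ConstFree, SFm.weakImp, SFm.imp2, x, y, z]; done)
    | (intro B _ v
       simp +contextual [SFm.twist_weakImp, SFm.toN, NFm.twist, NFm.twist_strongImp,
         himp_himp]
       done)
    | (intro B _ v
       simp only [SFm.twist_weakImp, List.forall_mem_cons, himp_eq_top_iff]
       exact fun k => k.1.trans k.2.1)

/-- The value in the quotient by `L Γ` gives a twist valuation if `L` strengthens N4 and S. -/
theorem exists_rep (hL : IsLogic L) (hS : LogicS ≤ L) (h4 : StrongN4 ≤ L) (Γ : Set SFm) :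
    ∃ (B : Type) (_ : GeneralizedHeytingAlgebra B) (t f : SFm → B), IsTwistHom t f ∧
      ∀ φ, t φ = ⊤ ↔ L Γ φ := by
  obtain ⟨B, _, t, hs, hle, hand, hor, himp, htop⟩ := (hL.preHeyting h4 Γ).exists_rep
  let x : SFm := .var 0
  let y : SFm := .var 1
  have hT : ∀ φ, t φ = ⊤ ↔ L Γ φ := fun φ => by
    rw [← top_le_iff, ← htop, hle]
    constructor <;> intro k
    · refine hL.of_twist h4 φ (.var 0) φ [(y ⇒ˢ y).weakImp x] x ?_ ?_ ?_
        (List.forall_mem_cons.2 ⟨k, List.forall_mem_nil _⟩)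
      · simp [SFm.ConstFree, SFm.weakImp, SFm.imp2, x, y]
      · simp [SFm.ConstFree, x]
      · intro B _ v
        simp [SFm.twist_weakImp, SFm.toN, NFm.twist_strongImp]
    · refine hL.of_twist h4 φ (.var 0) φ [x] ((y ⇒ˢ y).weakImp x) ?_ ?_ ?_
        (List.forall_mem_cons.2 ⟨k, List.forall_mem_nil _⟩)
      · simp [SFm.ConstFree, x]
      · simp [SFm.ConstFree, SFm.weakImp, SFm.imp2, x, y]
      · intro B _ v
        simp [SFm.twist_weakImp, SFm.toN, NFm.twist_strongImp]
  -- Formulas with equal first coordinates in all twist structures have the same class; this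
  -- transfers the twist identities to `t`.
  have E : ∀ φ ψ c d : SFm, c.ConstFree → d.ConstFree →
      (∀ (B : Type) [GeneralizedHeytingAlgebra B] (v : ℕ → B × B),
        (c.toN.twist v).1 = (d.toN.twist v).1) →
      t (c.subst (subst₃ φ ψ φ)) = t (d.subst (subst₃ φ ψ φ)) := by
    have key : ∀ φ ψ c d : SFm, c.ConstFree → d.ConstFree →
        (∀ (B : Type) [GeneralizedHeytingAlgebra B] (v : ℕ → B × B),
          (c.toN.twist v).1 = (d.toN.twist v).1) →
        t (c.subst (subst₃ φ ψ φ)) ≤ t (d.subst (subst₃ φ ψ φ)) := by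
      intro φ ψ c d hc hd h
      rw [hle]
      refine hL.of_twist h4 φ ψ φ [] (c.weakImp d) (by simp) ?_ ?_ (by simp)
      · simp [SFm.ConstFree, SFm.weakImp, SFm.imp2, hc, hd]
      · intro B _ v _
        rw [SFm.twist_weakImp, h, himp_self]
    exact fun φ ψ c d hc hd h =>
      le_antisymm (key φ ψ c d hc hd h) (key φ ψ d c hd hc fun B _ v => (h B v).symm)
  have timp : ∀ φ ψ, t (φ ⇒ˢ ψ) = (t φ ⇨ t ψ) ⊓ (t (¬ˢ ψ) ⇨ t (¬ˢ φ)) := fun φ ψ => by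
    rw [← himp, ← himp, ← hand]
    refine E φ ψ (x ⇒ˢ y) (x.weakImp y ∧ˢ (¬ˢ y).weakImp (¬ˢ x)) ?_ ?_ ?_
    · simp [SFm.ConstFree, x, y]
    · simp [SFm.ConstFree, SFm.weakImp, SFm.imp2, x, y]
    · intro B _ v
      simp [SFm.twist_weakImp, SFm.toN, NFm.twist_strongImp, NFm.twist]
  have fimp : ∀ φ ψ, t (¬ˢ (φ ⇒ˢ ψ)) = t φ ⊓ t (¬ˢ ψ) := fun φ ψ => by
    rw [← hand]
    refine E φ ψ (¬ˢ (x ⇒ˢ y)) (x ∧ˢ ¬ˢ y) ?_ ?_ ?_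
    · simp [SFm.ConstFree, x, y]
    · simp [SFm.ConstFree, x, y]
    · intro B _ v
      simp [SFm.toN, NFm.twist_strongImp, NFm.twist]
  have hS' : ∀ φ, LogicS Γ φ → t φ = ⊤ := fun φ h => (hT φ).2 (hS _ _ h)
  have zle : ∀ b, t SFm.zero ≤ b := fun b => by
    obtain ⟨ψ, rfl⟩ := hs b
    have k := hS' _ (.ax (.a2 ψ))
    rw [timp, inf_eq_top_iff, himp_eq_top_iff] at k
    exact k.1
  refine ⟨B, _, t, fun φ => t (¬ˢ φ), ⟨hand, fun φ ψ => ?_, hor, fun φ ψ => ?_, timp, fimp,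
    fun φ => rfl, fun φ => ?_, zle, hS' _ (.ax .a4), fun φ b => ?_⟩, hT⟩
  · rw [← hor]
    refine E φ ψ (¬ˢ (x ∧ˢ y)) (¬ˢ x ∨ˢ ¬ˢ y) ?_ ?_ fun B _ v => rfl <;>
      simp [SFm.ConstFree, x, y]
  · rw [← hand]
    refine E φ ψ (¬ˢ (x ∨ˢ y)) (¬ˢ x ∧ˢ ¬ˢ y) ?_ ?_ fun B _ v => rfl <;>
      simp [SFm.ConstFree, x, y]
  · refine E φ φ (¬ˢ (¬ˢ x)) x ?_ ?_ fun B _ v => rfl <;> simp [SFm.ConstFree, x]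
  -- The logical counterpart of `a ⇒ a = 1`: S proves this implication by weakening. Its
  -- contrapositive half reads `t φ ⊓ t (¬φ) ≤ t 0 ⊓ t (¬0)`, and `t 0` is least.
  · have k := hS' ((SFm.zero ⇒ˢ SFm.zero) ⇒ˢ (φ ⇒ˢ φ)) (.rule (.impR _ _) (by
      simpa using .ax (.a1 φ)))
    rw [timp, inf_eq_top_iff, himp_eq_top_iff, himp_eq_top_iff, fimp, fimp] at k
    exact k.2.trans (inf_le_left.trans (zle b))

theorem strongN3_le (hL : IsLogic L) (hS : LogicS ≤ L) (h4 : StrongN4 ≤ L) : StrongN3 ≤ L := by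
  intro Γ φ h
  obtain ⟨B, _, t, f, ht, hT⟩ := hL.exists_rep hS h4 Γ
  exact (hT φ).1 (ht.strongN3_eq_top h fun γ hγ => (hT γ).2 (hL.refl _ _ hγ))

end IsLogic

end Nelson

theorem mainTheorem11 :
    -- in the language of weak implication
    (∀ (A : Type u) [Nonempty A] (M : Nelson.WeakAlg A),
      M.IsN3Lattice ↔ (∃ z o : A, (M.toStrong z o).IsSAlgebra) ∧ M.IsN4Lattice) ∧
    -- in the common language of strong implication
    (∀ A : Type u,
      {S : Nelson.StrongAlg A | S.IsN3Lattice} =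
        {S : Nelson.StrongAlg A | S.IsSAlgebra} ∩ {S : Nelson.StrongAlg A | S.IsN4Lattice}) ∧
    -- N3 is the weakest among the strengthenings of S that also strengthen N4
    IsLeast {L : Set Nelson.SFm → Nelson.SFm → Prop |
        Nelson.IsLogic L ∧ Nelson.LogicS ≤ L ∧ Nelson.StrongN4 ≤ L} Nelson.StrongN3 :=
  ⟨fun _ _ _ => Nelson.WeakAlg.isN3Lattice_iff,
    fun _ => Set.ext fun _ => Nelson.StrongAlg.isN3Lattice_iff,
    ⟨Nelson.StrongN3.isLogic, fun _ _ => Nelson.LogicS.strongN3,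
      fun _ _ => Nelson.StrongN4.strongN3⟩,
    fun _ hL => hL.1.strongN3_le hL.2.1 hL.2.2⟩
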